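/- Let $X$ be a (real or complex) Banach space with scalar field $\mathbb K$, and let $\mathcal S=\{T(t)\}_{t\ge 0}\subset L(X)$ be a bounded $C_0$-semigroup. Let $X^{\odot}=\{x^*\in X^*:\lim_{t\to 0}\|T^*(t)x^*-x^*\|=0\}$ be its sun dual and $T^{\odot}(t)=T^*(t)|_{X^{\odot}}$ the sun-dual semigroup. Let $\mathcal T=\mathrm{co}(\mathcal S)$ and $\mathcal U=\mathrm{ac}(\mathcal S)$ be the convex hull and the absolutely convex hull of $\mathcal S$ in $L(X)$. Regard $L(X)\subset L(X,X^{**})$ through the canonical embedding $X\to X^{**}$. For $U\in L(X,X^{**})$ let $\eta(U)\in L(X^*)$ be given by $\langle x,\eta(U)x^*\rangle=\langle Ux,x^*\rangle$, and for $U,V\in L(X,X^{**})$ let $U\circ V\in L(X,X^{**})$ be given by $\langle (U\circ V)x,x^*\rangle=\langle Vx,\eta(U)x^*\rangle$ ($x\in X$, $x^*\in X^*$). For $\mathcal V\in\{\mathcal S,\mathcal T,\mathcal U\}$ define the compactification $\mathcal V_0=\eta^{-1}\bigl(\overline{\eta(\mathcal V)}\bigr)\subset L(X,X^{**})$, the closure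 being taken in $L(X^*)$ for the topology of pointwise convergence of $\langle x,Wx^*\rangle$ for all $x\in X$, $x^*\in X^*$. Every $V\in\mathcal V_0$ satisfies $\eta(V)X^{\odot}\subset X^{\odot}$; put $\eta^{\odot}(V)=\eta(V)|_{X^{\odot}}$ and define the dual compactification $\mathcal V_0^{\odot}=\eta^{\odot}(\mathcal V_0)\subset L(X^{\odot})$. Let $W(\mathbb R^+)$ be the set of Eberlein weakly almost periodic functions, i.e. of those bounded continuous $f:[0,\infty)\to\mathbb K$ for which the set of translates $\{f(\cdot+\tau):\tau\ge 0\}$ is relatively weakly compact in the Banach space $C_b([0,\infty),\mathbb K)$. **Theorem 6.6.** Let $\mathcal V\in\{\mathcal S,\mathcal T,\mathcal U\}$. (1) For every $x\in X$: the function $t\mapsto\langle T(t)x,x^{\odot}\rangle$ belongs to $W(\mathbb R^+)$ for all $x^{\odot}\in X^{\odot}$ if and only if $(U\circ V)x=(V\circ U)x$ for all $U,V\in\mathcal V_0$. (2) For every $x^{\odot}\in X^{\odot}$: the function $t\mapsto\langle x,T^{\odot}(t)x^{\odot}\rangle$ belongs to $W(\mathbb R^+)$ for all $x\in X$ if and only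 if $UVx^{\odot}=VUx^{\odot}$ for all $U,V\in\mathcal V_0^{\odot}$. -/

import Mathlib

open Filter Topology Set
open scoped NNReal BoundedContinuousFunction ComplexOrder

noncomputable section

/-- A bounded `C₀`-semigroup `{T(t)}_{t ≥ 0}` of bounded linear operators on a normed space. -/
structure BoundedC0Semigroup (𝕜 X : Type*) [RCLike 𝕜] [NormedAddCommGroup X]
    [NormedSpace 𝕜 X] where
  op : ℝ≥0 → X →L[𝕜] X
  op_zero : op 0 = ContinuousLinearMap.id 𝕜 X
  op_add : ∀ s t : ℝ≥0, op (s + t) = (op s).comp (op t)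
  tendsto_op_zero : ∀ x : X, Tendsto (fun t : ℝ≥0 => op t x) (𝓝 0) (𝓝 x)
  bounded : ∃ M : ℝ, ∀ t : ℝ≥0, ‖op t‖ ≤ M

/-- The right translate `f_τ : t ↦ f (t + τ)` of a bounded continuous function on `[0, ∞)`. -/
def translateBCF {E : Type*} [NormedAddCommGroup E] (f : ℝ≥0 →ᵇ E) (τ : ℝ≥0) : ℝ≥0 →ᵇ E :=
  f.compContinuous ⟨fun t => t + τ, by fun_prop⟩

/-- `f ∈ W(ℝ⁺, E)`: the function `f` is bounded and continuous, and the set `{f_τ : τ ≥ 0}` of its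
translates is relatively weakly compact in the Banach space `C_b(ℝ⁺, E)`. -/
def IsEberleinWAP (𝕜 : Type*) {E : Type*} [RCLike 𝕜] [NormedAddCommGroup E] [NormedSpace 𝕜 E]
    (f : ℝ≥0 → E) : Prop :=
  ∃ g : ℝ≥0 →ᵇ E, ⇑g = f ∧
    IsCompact (closure (toWeakSpace 𝕜 (ℝ≥0 →ᵇ E) '' Set.range (translateBCF g)))

section Operators

variable (𝕜 X Y : Type*) [RCLike 𝕜] [NormedAddCommGroup X] [NormedSpace 𝕜 X]
  [NormedAddCommGroup Y] [NormedSpace 𝕜 Y]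

/-- The `w*`-operator topology on `L(X, Y*)`: `T_λ → T` iff `⟨T_λ x, y⟩ → ⟨T x, y⟩` for all
`x ∈ X` and `y ∈ Y`. -/
@[reducible]
def wStarOT : TopologicalSpace (X →L[𝕜] StrongDual 𝕜 Y) :=
  TopologicalSpace.induced (fun T (p : X × Y) => T p.1 p.2) Pi.topologicalSpace

variable {𝕜 X}

/-- `η : L(X, X**) → L(X*)`, `⟨x, η(U) x*⟩ = ⟨U x, x*⟩`; that is, `η(U)` is the restriction of
`U*` to `X* ⊆ X***`. -/
def eta (U : X →L[𝕜] StrongDual 𝕜 (StrongDual 𝕜 X)) : StrongDual 𝕜 X →L[𝕜] StrongDual 𝕜 X :=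
  U.flip

/-- The product on `L(X, X**)`: `⟨(U ∘ V) x, x*⟩ = ⟨V x, U* x*⟩`. -/
def circ (U V : X →L[𝕜] StrongDual 𝕜 (StrongDual 𝕜 X)) :
    X →L[𝕜] StrongDual 𝕜 (StrongDual 𝕜 X) :=
  ((ContinuousLinearMap.compL 𝕜 (StrongDual 𝕜 X) (StrongDual 𝕜 X) 𝕜).flip (eta U)).comp V

theorem circ_apply (U V : X →L[𝕜] StrongDual 𝕜 (StrongDual 𝕜 X)) (x : X) (y : StrongDual 𝕜 X) :
    circ U V x y = V x (eta U y) := rfl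

/-- The inclusion `L(X) ⊆ L(X, X**)` given by the canonical embedding `X → X**`. -/
def toBidual (B : X →L[𝕜] X) : X →L[𝕜] StrongDual 𝕜 (StrongDual 𝕜 X) :=
  (NormedSpace.inclusionInDoubleDual 𝕜 X).comp B

/-- The compactification `𝒱₀ = η⁻¹(closure of η(𝒱))` of a set `𝒱 ⊆ L(X) ⊆ L(X, X**)`, the closure
being taken in `L(X*)` for the `w*`-operator topology. -/
def compactification (𝒱 : Set (X →L[𝕜] X)) : Set (X →L[𝕜] StrongDual 𝕜 (StrongDual 𝕜 X)) :=
  eta ⁻¹' (closure[wStarOT 𝕜 (StrongDual 𝕜 X) X] ((fun B => eta (toBidual B)) '' 𝒱))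

end Operators

namespace BoundedC0Semigroup

variable {𝕜 X : Type*} [RCLike 𝕜] [NormedAddCommGroup X] [NormedSpace 𝕜 X]
  (T : BoundedC0Semigroup 𝕜 X)

/-- `𝒮 = {T(t) : t ≥ 0}`. -/
def orbitS : Set (X →L[𝕜] X) := Set.range T.op

/-- `𝒯 = co(𝒮)`, the convex hull (`0 ≤ a` in `𝕜` means that `a` is a nonnegative real number). -/
def hullT : Set (X →L[𝕜] X) := convexHull 𝕜 T.orbitS

/-- `𝒰 = ac(𝒮)`, the absolutely convex hull. -/
def hullU : Set (X →L[𝕜] X) := absConvexHull 𝕜 T.orbitS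

/-- The adjoint operator `T*(t)` on `X*`. -/
def dualOp (t : ℝ≥0) : StrongDual 𝕜 X →L[𝕜] StrongDual 𝕜 X :=
  (ContinuousLinearMap.compL 𝕜 X X 𝕜).flip (T.op t)

theorem dualOp_apply (t : ℝ≥0) (y : StrongDual 𝕜 X) (x : X) : T.dualOp t y x = y (T.op t x) := rfl

/-- The sun dual `X^⊙ = {x* ∈ X* : T*(t) x* → x* in norm as t → 0}`. -/
def sunDual : Submodule 𝕜 (StrongDual 𝕜 X) where
  carrier := {y | Tendsto (fun t : ℝ≥0 => T.dualOp t y) (𝓝 0) (𝓝 y)}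
  zero_mem' := by simp
  add_mem' := fun {a b} ha hb => by
    simp only [mem_ofPred_eq, map_add] at *
    exact ha.add hb
  smul_mem' := fun c a ha => by
    simp only [mem_ofPred_eq, map_smul] at *
    exact ha.const_smul c

theorem mem_sunDual {y : StrongDual 𝕜 X} :
    y ∈ T.sunDual ↔ Tendsto (fun t : ℝ≥0 => T.dualOp t y) (𝓝 0) (𝓝 y) := Iff.rfl

/-- An operator on `X*` which commutes with all `T*(t)` leaves `X^⊙` invariant. -/
theorem mapsTo_sunDual (W : StrongDual 𝕜 X →L[𝕜] StrongDual 𝕜 X)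
    (hW : ∀ t y, W (T.dualOp t y) = T.dualOp t (W y)) : ∀ y ∈ T.sunDual, W y ∈ T.sunDual := by
  intro y hy
  rw [mem_sunDual] at hy ⊢
  simpa only [Function.comp_def, hW] using (W.continuous.tendsto y).comp hy

theorem dualOp_comm (s t : ℝ≥0) (y : StrongDual 𝕜 X) :
    T.dualOp s (T.dualOp t y) = T.dualOp t (T.dualOp s y) := by
  ext x
  have h : (T.op t).comp (T.op s) = (T.op s).comp (T.op t) := by
    rw [← T.op_add, ← T.op_add, add_comm]
  exact congrArg y (DFunLike.congr_fun h x)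

/-- The sun-dual semigroup `T^⊙(t)` on `X^⊙`, the restriction of `T*(t)`. -/
def sunOp (t : ℝ≥0) : T.sunDual →L[𝕜] T.sunDual :=
  (T.dualOp t).restrict (T.mapsTo_sunDual (T.dualOp t) (T.dualOp_comm t))

/-- `η^⊙(V) ∈ L(X^⊙)`, `⟨x, η^⊙(V) x^⊙⟩ = ⟨V x, x^⊙⟩`, for an operator `V ∈ L(X, X**)` with
`V* X^⊙ ⊆ X^⊙`. -/
def etaSun (V : X →L[𝕜] StrongDual 𝕜 (StrongDual 𝕜 X))
    (hV : ∀ y ∈ T.sunDual, eta V y ∈ T.sunDual) : T.sunDual →L[𝕜] T.sunDual :=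
  (eta V).restrict hV

/-- The dual compactification `𝒱₀^⊙ = η^⊙(𝒱₀) ⊆ L(X^⊙)`. For `𝒱 ∈ {𝒮, 𝒯, 𝒰}` every element of
`𝒱₀` lies in the domain of `η^⊙`, see `eta_mem_sunDual` below. -/
def sunCompactification (𝒱 : Set (X →L[𝕜] X)) : Set (T.sunDual →L[𝕜] T.sunDual) :=
  {W | ∃ V ∈ compactification 𝒱, ∃ hV : ∀ y ∈ T.sunDual, eta V y ∈ T.sunDual, W = T.etaSun V hV}

theorem absConvex_commutant :
    AbsConvex 𝕜 {B : X →L[𝕜] X | ∀ t, B.comp (T.op t) = (T.op t).comp B} := by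
  refine ⟨?_, ?_⟩
  · rw [balanced_iff_smul_mem]
    intro a _ B hB t
    simp only [mem_ofPred_eq] at hB
    ext x
    have h := DFunLike.congr_fun (hB t) x
    simp only [ContinuousLinearMap.comp_apply] at h
    simp [h]
  · intro B hB C hC a b _ _ _ t
    simp only [mem_ofPred_eq] at hB hC
    ext x
    have h := DFunLike.congr_fun (hB t) x
    have h' := DFunLike.congr_fun (hC t) x
    simp only [ContinuousLinearMap.comp_apply] at h h'
    simp [h, h']

theorem orbitS_subset_hullU : T.orbitS ⊆ T.hullU := subset_absConvexHull

theorem hullT_subset_hullU : T.hullT ⊆ T.hullU :=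
  convexHull_min subset_absConvexHull absConvex_absConvexHull.2

theorem hullU_comm (B : X →L[𝕜] X) (hB : B ∈ T.hullU) (t : ℝ≥0) :
    B.comp (T.op t) = (T.op t).comp B := by
  refine absConvexHull_min (s := T.orbitS) ?_ T.absConvex_commutant hB t
  rintro _ ⟨s, rfl⟩ t
  rw [← T.op_add, ← T.op_add, add_comm]

/-- The elements of `𝒱₀`, for `𝒱 ⊆ 𝒰`, leave `X^⊙` invariant. -/
theorem eta_mem_sunDual {𝒱 : Set (X →L[𝕜] X)} (h𝒱 : 𝒱 ⊆ T.hullU)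
    {V : X →L[𝕜] StrongDual 𝕜 (StrongDual 𝕜 X)} (hV : V ∈ compactification 𝒱) :
    ∀ y ∈ T.sunDual, eta V y ∈ T.sunDual := by
  refine T.mapsTo_sunDual _ fun t y => ?_
  ext x
  let _ : TopologicalSpace (StrongDual 𝕜 X →L[𝕜] StrongDual 𝕜 X) := wStarOT 𝕜 (StrongDual 𝕜 X) X
  have hc : ∀ (z : StrongDual 𝕜 X) (x : X),
      Continuous fun W : StrongDual 𝕜 X →L[𝕜] StrongDual 𝕜 X => W z x := fun z x =>
    (continuous_apply (A := fun _ : StrongDual 𝕜 X × X => 𝕜) (z, x)).comp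
      (continuous_induced_dom (f := fun (W : StrongDual 𝕜 X →L[𝕜] StrongDual 𝕜 X)
        (p : StrongDual 𝕜 X × X) => W p.1 p.2))
  have hcl : IsClosed {W : StrongDual 𝕜 X →L[𝕜] StrongDual 𝕜 X |
      W (T.dualOp t y) x = W y (T.op t x)} := isClosed_eq (hc _ _) (hc _ _)
  refine closure_minimal ?_ hcl hV
  rintro _ ⟨B, hB, rfl⟩
  exact congrArg y (DFunLike.congr_fun (T.hullU_comm B (h𝒱 hB) t) x).symm

end BoundedC0Semigroup

end

/-! Everything reduces to one pair `y`, `x`: the function `t ↦ y (T(t) x)` is weakly almost periodic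
iff `U (V y) x = V (U y) x` for all `U`, `V` in the w*-operator closure of the adjoints of `𝒱`. Weak
compactness of the translates gives commutation over the closure of `𝒮` by a Grothendieck
double-limit argument (`apply_comm_of_isEberleinWAP`). Commutation passes from `𝒮` to `𝒰` because
operators in the closure of `𝒰` are barycenters of scalar measures on the compact closure of `𝒮`,
and commutation makes the kernels being integrated separately continuous (`exists_barycenter`,
`apply_comm_of_orbitClosure`). Conversely, every functional of norm at most one on `C_b` acts on
orbit functions as an operator in the closure of `𝒰` (`exists_adjointClosure_eq`); commutation then
makes the translates part of a weakly continuous image of a compact space. Part (2) is the pairwise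
statement with `y` fixed in the sun dual. Part (1) also needs commutation on the sun dual to extend
to all of `X*`, which follows by averaging the semigroup near `0` (`apply_comm_of_sunDual`). -/

noncomputable section

open MeasureTheory

/-! ### Measures on compact spaces and integrals of separately continuous kernels -/

open CompactlySupported in
/-- The finite measures of mass at most one on a compact Hausdorff space are weakly compact. -/
theorem isCompact_setOf_mass_le_one (P : Type*) [TopologicalSpace P] [CompactSpace P] [T2Space P]
    [MeasurableSpace P] [BorelSpace P] : IsCompact {ν : FiniteMeasure P | ν.mass ≤ 1} := by
  rw [isCompact_iff_ultrafilter_le_nhds']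
  intro 𝒜 h𝒜
  have hbound : ∀ (h : C_c(P, ℝ)) (ν : FiniteMeasure P), ν.mass ≤ 1 → ∀ C : ℝ, 0 ≤ C →
      (∀ p, ‖h p‖ ≤ C) → ‖∫ p, h p ∂(ν : Measure P)‖ ≤ C := by
    intro h ν hν C hC hh
    refine (norm_integral_le_of_norm_le_const (.of_forall hh)).trans ?_
    have : (ν : Measure P).real univ ≤ 1 := by exact_mod_cast hν
    exact mul_le_of_le_one_right hC this
  have hlim : ∀ h : C_c(P, ℝ), ∃ a : ℝ,
      Tendsto (fun ν : FiniteMeasure P => ∫ p, h p ∂(ν : Measure P)) 𝒜 (𝓝 a) := by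
    intro h
    obtain ⟨C, hC⟩ := (isCompact_range h.continuous).isBounded.exists_norm_le
    have hC' : ∀ p, ‖h p‖ ≤ max C 0 := fun p => (hC _ ⟨p, rfl⟩).trans (le_max_left _ _)
    obtain ⟨a, -, ha⟩ := (isCompact_closedBall (0 : ℝ) (max C 0)).ultrafilter_le_nhds'
      (𝒜.map fun ν : FiniteMeasure P => ∫ p, h p ∂(ν : Measure P)) (by
        refine Ultrafilter.mem_map.2 (mem_of_superset h𝒜 fun ν hν => ?_)
        simpa using hbound h ν hν _ (le_max_right _ _) hC')
    exact ⟨a, ha⟩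
  choose Λ hΛ using hlim
  have hint : ∀ (h : C_c(P, ℝ)) (ν : FiniteMeasure P), Integrable h (ν : Measure P) := fun h ν =>
    h.continuous.integrable_of_hasCompactSupport h.hasCompactSupport
  -- The limits of integrals along the ultrafilter form a positive functional, whose Riesz measure
  -- is the limit point.
  let Φ : C_c(P, ℝ) →ₚ[ℝ] ℝ := PositiveLinearMap.mk₀
    { toFun := Λ
      map_add' := fun f g => tendsto_nhds_unique (hΛ (f + g)) (by
        refine ((hΛ f).add (hΛ g)).congr fun ν => ?_
        exact (integral_add (hint f ν) (hint g ν)).symm)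
      map_smul' := fun c f => tendsto_nhds_unique (hΛ (c • f)) (by
        refine ((hΛ f).const_smul c).congr fun ν => ?_
        exact (integral_smul c f).symm) }
    (fun g hg => ge_of_tendsto (hΛ g) (.of_forall fun ν => integral_nonneg fun p => hg p))
  let ν₀ : FiniteMeasure P := ⟨RealRMK.rieszMeasure Φ, inferInstance⟩
  have hν₀ : ∀ h : C_c(P, ℝ), ∫ p, h p ∂(ν₀ : Measure P) = Λ h := fun h =>
    RealRMK.integral_rieszMeasure Φ h
  refine ⟨ν₀, ?_, ?_⟩
  · have h1 := hν₀ ⟨1, HasCompactSupport.of_compactSpace 1⟩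
    have h2 : Λ ⟨1, HasCompactSupport.of_compactSpace 1⟩ ≤ 1 := by
      refine le_of_tendsto (hΛ _) ?_
      filter_upwards [h𝒜] with ν hν
      exact (le_abs_self _).trans (hbound _ ν hν 1 zero_le_one fun p => norm_one.le)
    have h3 : ∫ _ : P, (1 : ℝ) ∂(ν₀ : Measure P) ≤ 1 := h1.trans_le h2
    have h4 : (ν₀ : Measure P).real univ ≤ 1 := by
      rwa [integral_const, smul_eq_mul, mul_one] at h3
    exact_mod_cast h4
  · refine FiniteMeasure.tendsto_iff_forall_integral_tendsto.2 fun h => ?_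
    have := hΛ ⟨h.toContinuousMap, HasCompactSupport.of_compactSpace _⟩
    rwa [← hν₀] at this

/-- A bounded separately continuous kernel on `P × Q`, with `P` separable and `Q` compact, has
continuous integrals over `P`. -/
theorem continuous_integral_of_separatelyContinuous {𝕜 P Q : Type*} [RCLike 𝕜]
    [TopologicalSpace P] [TopologicalSpace.SeparableSpace P] [MeasurableSpace P]
    [OpensMeasurableSpace P] [TopologicalSpace Q] [CompactSpace Q] (ν : Measure P)
    [IsFiniteMeasure ν] (β : P → Q → 𝕜) (hP : ∀ q, Continuous fun p => β p q)
    (hQ : ∀ p, Continuous (β p)) {C : ℝ} (hC : ∀ p q, ‖β p q‖ ≤ C) :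
    Continuous fun q => ∫ p, β p q ∂ν := by
  obtain ⟨D, hDc, hDd⟩ := TopologicalSpace.exists_countable_dense P
  have : Countable D := hDc
  -- The kernel factors through the image of `Q` in the metrizable space `D → 𝕜`. That image is
  -- first countable, so dominated convergence proves continuity there; compactness of `Q` makes the
  -- map onto it a quotient map.
  let ι : Q → (D → 𝕜) := fun q d => β d q
  have hι : Continuous ι := continuous_pi fun d => hQ d
  have hinj : ∀ q q', ι q = ι q' → ∀ p, β p q = β p q' := fun q q' h p =>
    congrFun (Continuous.ext_on hDd (hP q) (hP q') fun d hd => congrFun h ⟨d, hd⟩) p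
  have hquot : IsQuotientMap (rangeFactorization ι) :=
    (hι.subtype_mk _).isClosedMap.isQuotientMap (hι.subtype_mk _) rangeFactorization_surjective
  choose s hs using fun z : range ι => rangeFactorization_surjective z
  have hsι : ∀ q p, β p (s (rangeFactorization ι q)) = β p q := fun q p =>
    hinj _ _ (congrArg Subtype.val (hs (rangeFactorization ι q))) p
  have hcont : Continuous fun z : range ι => ∫ p, β p (s z) ∂ν := by
    refine continuous_of_dominated (bound := fun _ => C)
      (fun z => (hP _).aestronglyMeasurable) (fun z => .of_forall fun p => hC _ _)
      (integrable_const C) (.of_forall fun p => ?_)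
    rw [hquot.continuous_iff]
    simpa only [Function.comp_def, hsι] using hQ p
  simpa only [Function.comp_def, hsι] using hcont.comp hquot.continuous

/-! ### The w*-operator topology and closures of sets of adjoints -/

/-- The operators on `X*`, with the `w*`-operator topology. -/
def WStarOp (𝕜 X : Type*) [RCLike 𝕜] [NormedAddCommGroup X] [NormedSpace 𝕜 X] : Type _ :=
  StrongDual 𝕜 X →L[𝕜] StrongDual 𝕜 X

namespace WStarOp

variable {𝕜 X : Type*} [RCLike 𝕜] [NormedAddCommGroup X] [NormedSpace 𝕜 X]

instance : TopologicalSpace (WStarOp 𝕜 X) := wStarOT 𝕜 (StrongDual 𝕜 X) X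

instance : FunLike (WStarOp 𝕜 X) (StrongDual 𝕜 X) (StrongDual 𝕜 X) :=
  inferInstanceAs (FunLike (StrongDual 𝕜 X →L[𝕜] StrongDual 𝕜 X) _ _)

instance : ContinuousLinearMapClass (WStarOp 𝕜 X) 𝕜 (StrongDual 𝕜 X) (StrongDual 𝕜 X) :=
  inferInstanceAs (ContinuousLinearMapClass (StrongDual 𝕜 X →L[𝕜] StrongDual 𝕜 X) 𝕜 _ _)

theorem tendsto_iff {ι : Type*} {l : Filter ι} {f : ι → WStarOp 𝕜 X} {W : WStarOp 𝕜 X} :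
    Tendsto f l (𝓝 W) ↔ ∀ y x, Tendsto (fun i => f i y x) l (𝓝 (W y x)) := by
  have h : IsInducing fun (W : WStarOp 𝕜 X) (p : StrongDual 𝕜 X × X) => W p.1 p.2 := ⟨rfl⟩
  rw [h.tendsto_nhds_iff, tendsto_pi_nhds]
  exact ⟨fun H y x => H (y, x), fun H p => H p.1 p.2⟩

theorem continuous_eval (y : StrongDual 𝕜 X) (x : X) :
    Continuous fun W : WStarOp 𝕜 X => W y x :=
  continuous_iff_continuousAt.2 fun _ => tendsto_iff.1 tendsto_id y x

theorem continuous_of_eval {ι : Type*} [TopologicalSpace ι] {f : ι → WStarOp 𝕜 X}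
    (hf : ∀ y x, Continuous fun i => f i y x) : Continuous f :=
  continuous_iff_continuousAt.2 fun _ => tendsto_iff.2 fun y x => (hf y x).continuousAt

instance : T2Space (WStarOp 𝕜 X) :=
  T2Space.of_injective_continuous (f := fun W (p : StrongDual 𝕜 X × X) => W p.1 p.2)
    (fun _ _ h => DFunLike.ext _ _ fun y => ContinuousLinearMap.ext fun x => congrFun h (y, x))
    (continuous_pi fun p => continuous_eval p.1 p.2)

/-- An Alaoglu argument: the pointwise limits along an ultrafilter form a bounded bilinear form on
`X* × X`, hence an operator on `X*`. -/
theorem isCompact_of_isClosed_of_bound {K : Set (WStarOp 𝕜 X)} (hK : IsClosed K) {C : ℝ}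
    (hC : ∀ W ∈ K, ∀ y x, ‖W y x‖ ≤ C * ‖y‖ * ‖x‖) : IsCompact K := by
  rw [isCompact_iff_ultrafilter_le_nhds']
  intro 𝒜 h𝒜
  have hlim : ∀ (y : StrongDual 𝕜 X) (x : X), ∃ a : 𝕜, ‖a‖ ≤ C * ‖y‖ * ‖x‖ ∧
      Tendsto (fun W : WStarOp 𝕜 X => W y x) 𝒜 (𝓝 a) := by
    intro y x
    obtain ⟨a, ha, ha'⟩ := (isCompact_closedBall (0 : 𝕜) (C * ‖y‖ * ‖x‖)).ultrafilter_le_nhds'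
      (𝒜.map fun W : WStarOp 𝕜 X => W y x)
      (Ultrafilter.mem_map.2 (mem_of_superset h𝒜 fun W hW => by simpa using hC W hW y x))
    exact ⟨a, by simpa using ha, ha'⟩
  choose L hL hLt using hlim
  let W₀ : StrongDual 𝕜 X →L[𝕜] StrongDual 𝕜 X :=
    (LinearMap.mk₂ 𝕜 L
      (fun y y' x => tendsto_nhds_unique (hLt _ _) (by simpa using (hLt y x).add (hLt y' x)))
      (fun c y x => tendsto_nhds_unique (hLt _ _) (by simpa using (hLt y x).const_mul c))
      (fun y x x' => tendsto_nhds_unique (hLt _ _) (by simpa using (hLt y x).add (hLt y x')))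
      (fun c y x => tendsto_nhds_unique (hLt _ _) (by simpa using (hLt y x).const_mul c))
      ).mkContinuous₂ C hL
  let W₁ : WStarOp 𝕜 X := W₀
  have hW₁ : (𝒜 : Filter (WStarOp 𝕜 X)) ≤ 𝓝 W₁ := tendsto_id'.1 (tendsto_iff.2 hLt)
  exact ⟨W₁, hK.mem_of_tendsto hW₁ h𝒜, hW₁⟩

/-- The adjoint of a bounded operator. -/
def adjoint (B : X →L[𝕜] X) : WStarOp 𝕜 X := eta (toBidual B)

theorem adjoint_apply (B : X →L[𝕜] X) (y : StrongDual 𝕜 X) (x : X) : adjoint B y x = y (B x) := rfl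

/-- The `w*`-operator closure of the adjoints of a set of operators. -/
def adjointClosure (𝒱 : Set (X →L[𝕜] X)) : Set (WStarOp 𝕜 X) := closure (adjoint '' 𝒱)

theorem adjointClosure_mono {𝒱 𝒱' : Set (X →L[𝕜] X)} (h : 𝒱 ⊆ 𝒱') :
    adjointClosure 𝒱 ⊆ adjointClosure 𝒱' := closure_mono (image_mono h)

theorem adjoint_mem_adjointClosure {𝒱 : Set (X →L[𝕜] X)} {B : X →L[𝕜] X} (hB : B ∈ 𝒱) :
    adjoint B ∈ adjointClosure 𝒱 := subset_closure ⟨B, hB, rfl⟩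

/-- Since `eta` is the involution `flip`, nothing is lost in passing between `𝒱₀` and the closure in
`L(X*)`. -/
theorem flip_mem_compactification {𝒱 : Set (X →L[𝕜] X)} {W : WStarOp 𝕜 X}
    (hW : W ∈ adjointClosure 𝒱) :
    ContinuousLinearMap.flip (W : StrongDual 𝕜 X →L[𝕜] StrongDual 𝕜 X) ∈ compactification 𝒱 := hW

theorem apply_comm_of_mem_adjointClosure {𝒱 : Set (X →L[𝕜] X)} {W : WStarOp 𝕜 X}
    (hW : W ∈ adjointClosure 𝒱) {A : X →L[𝕜] X} (hA : ∀ B ∈ 𝒱, B.comp A = A.comp B)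
    (y : StrongDual 𝕜 X) (x : X) : W (adjoint A y) x = W y (A x) := by
  refine closure_minimal (t := {W : WStarOp 𝕜 X | W (adjoint A y) x = W y (A x)}) ?_
    (isClosed_eq (continuous_eval _ _) (continuous_eval _ _)) hW
  rintro _ ⟨B, hB, rfl⟩
  exact congrArg y (DFunLike.congr_fun (hA B hB) x).symm

theorem norm_apply_le_of_mem_adjointClosure {𝒱 : Set (X →L[𝕜] X)} {C : ℝ}
    (hC : ∀ B ∈ 𝒱, ‖B‖ ≤ C) {W : WStarOp 𝕜 X} (hW : W ∈ adjointClosure 𝒱) (y : StrongDual 𝕜 X)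
    (x : X) : ‖W y x‖ ≤ C * ‖y‖ * ‖x‖ := by
  refine closure_minimal (t := {W : WStarOp 𝕜 X | ‖W y x‖ ≤ C * ‖y‖ * ‖x‖}) ?_
    (isClosed_le (continuous_eval _ _).norm continuous_const) hW
  rintro _ ⟨B, hB, rfl⟩
  calc ‖y (B x)‖ ≤ ‖y‖ * (‖B‖ * ‖x‖) := y.le_opNorm_of_le (B.le_opNorm x)
    _ ≤ ‖y‖ * (C * ‖x‖) := by gcongr; exact hC B hB
    _ = C * ‖y‖ * ‖x‖ := by ring

theorem isCompact_adjointClosure {𝒱 : Set (X →L[𝕜] X)} {C : ℝ} (hC : ∀ B ∈ 𝒱, ‖B‖ ≤ C) :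
    IsCompact (adjointClosure 𝒱) :=
  isCompact_of_isClosed_of_bound isClosed_closure fun _ hW =>
    norm_apply_le_of_mem_adjointClosure hC hW

end WStarOp

/-! ### Barycenters over the orbit closure, and commutation for the hulls -/

namespace BoundedC0Semigroup

open WStarOp

variable {𝕜 X : Type*} [RCLike 𝕜] [NormedAddCommGroup X] [NormedSpace 𝕜 X]
  (T : BoundedC0Semigroup 𝕜 X)

theorem exists_bound_hullU : ∃ M : ℝ, 0 ≤ M ∧ ∀ B ∈ T.hullU, ‖B‖ ≤ M := by
  obtain ⟨M, hM⟩ := T.bounded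
  have hM0 : 0 ≤ M := (norm_nonneg _).trans (hM 0)
  refine ⟨M, hM0, fun B hB => ?_⟩
  have h := absConvexHull_min (s := T.orbitS) (t := Metric.closedBall (0 : X →L[𝕜] X) M) (𝕜 := 𝕜)
    (by rintro _ ⟨t, rfl⟩; simpa using hM t) ⟨balanced_closedBall_zero, ?_⟩ hB
  · simpa using h
  · intro a ha b hb r s hr hs hrs
    simp only [mem_closedBall_zero_iff] at *
    calc ‖r • a + s • b‖ ≤ ‖r‖ * M + ‖s‖ * M := by
          refine (norm_add_le _ _).trans ?_
          rw [norm_smul, norm_smul]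
          gcongr
      _ = M := by
          have h1 : ((‖r‖ + ‖s‖ : ℝ) : 𝕜) = 1 := by
            rw [RCLike.ofReal_add, RCLike.norm_of_nonneg' hr, RCLike.norm_of_nonneg' hs, hrs]
          rw [← add_mul, show ‖r‖ + ‖s‖ = 1 by exact_mod_cast h1, one_mul]

theorem isCompact_adjointClosure {𝒱 : Set (X →L[𝕜] X)} (h𝒱 : 𝒱 ⊆ T.hullU) :
    IsCompact (adjointClosure 𝒱) :=
  let ⟨_, _, hM⟩ := T.exists_bound_hullU
  WStarOp.isCompact_adjointClosure fun B hB => hM B (h𝒱 hB)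

theorem continuous_op_apply (x : X) : Continuous fun t : ℝ≥0 => T.op t x := by
  obtain ⟨M, hM⟩ := T.bounded
  have hM0 : 0 ≤ M := (norm_nonneg _).trans (hM 0)
  have key : ∀ s t : ℝ≥0, s ≤ t →
      dist (T.op s x) (T.op t x) ≤ M * dist x (T.op (t - s) x) := by
    intro s t hst
    have h : T.op t x = T.op s (T.op (t - s) x) := by
      rw [← ContinuousLinearMap.comp_apply, ← T.op_add, add_tsub_cancel_of_le hst]
    rw [h, dist_eq_norm, ← map_sub, dist_eq_norm]
    exact (T.op s).le_of_opNorm_le (hM s) _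
  rw [continuous_iff_continuousAt]
  intro s
  rw [ContinuousAt, tendsto_iff_dist_tendsto_zero]
  -- With truncated subtraction this sum is `|t - s|`.
  have hd : Tendsto (fun t : ℝ≥0 => (t - s) + (s - t)) (𝓝 s) (𝓝 0) := by
    have : Continuous fun t : ℝ≥0 => (t - s) + (s - t) := by fun_prop
    simpa using this.tendsto s
  have h0 : Tendsto (fun t : ℝ≥0 => M * dist x (T.op ((t - s) + (s - t)) x)) (𝓝 s) (𝓝 0) := by
    have h1 := ((T.tendsto_op_zero x).comp hd)
    have h2 := (tendsto_const_nhds (x := x)).dist h1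
    simpa using h2.const_mul M
  refine squeeze_zero (fun _ => dist_nonneg) (fun t => ?_) h0
  rcases le_total s t with h | h
  · rw [tsub_eq_zero_of_le h, add_zero, dist_comm]; exact key s t h
  · rw [tsub_eq_zero_of_le h, zero_add]; exact key t s h

theorem continuous_adjoint_op : Continuous fun t : ℝ≥0 => adjoint (T.op t) :=
  continuous_of_eval fun y x => y.continuous.comp (T.continuous_op_apply x)

/-- The `w*`-operator closure of `{T*(t) : t ≥ 0}`. -/
abbrev orbitClosure : Type _ := adjointClosure T.orbitS

instance : CompactSpace T.orbitClosure :=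
  isCompact_iff_compactSpace.1 (T.isCompact_adjointClosure T.orbitS_subset_hullU)

instance : MeasurableSpace T.orbitClosure := borel _

instance : BorelSpace T.orbitClosure := ⟨rfl⟩

/-- The map `t ↦ T*(t)` into the orbit closure. -/
def toOrbitClosure (t : ℝ≥0) : T.orbitClosure :=
  ⟨adjoint (T.op t), adjoint_mem_adjointClosure ⟨t, rfl⟩⟩

theorem dense_adjoint {𝒱 : Set (X →L[𝕜] X)} :
    Dense {W : adjointClosure 𝒱 | ∃ B ∈ 𝒱, adjoint B = W} := by
  rw [Subtype.dense_iff]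
  refine closure_mono ?_
  rintro _ ⟨B, hB, rfl⟩
  exact ⟨⟨_, adjoint_mem_adjointClosure hB⟩, ⟨B, hB, rfl⟩, rfl⟩

instance : TopologicalSpace.SeparableSpace T.orbitClosure := by
  refine DenseRange.separableSpace (f := T.toOrbitClosure) ?_
    (T.continuous_adjoint_op.subtype_mk _)
  refine dense_adjoint.mono ?_
  rintro W ⟨_, ⟨t, rfl⟩, h⟩
  exact ⟨t, Subtype.ext h⟩

theorem continuous_orbitClosure_eval (y : StrongDual 𝕜 X) (x : X) :
    Continuous fun p : T.orbitClosure => (p : WStarOp 𝕜 X) y x :=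
  (continuous_eval y x).comp continuous_subtype_val

theorem integrable_orbitClosure_eval (ν : FiniteMeasure T.orbitClosure) (y : StrongDual 𝕜 X)
    (x : X) : Integrable (fun p : T.orbitClosure => (p : WStarOp 𝕜 X) y x)
      (ν : Measure T.orbitClosure) :=
  (T.continuous_orbitClosure_eval y x).integrable_of_hasCompactSupport
    (HasCompactSupport.of_compactSpace _)

/-- The units whose nonnegative multiples span the scalar field. -/
def unitCoeff (𝕜 : Type*) [RCLike 𝕜] : Fin 4 → 𝕜 := ![1, -1, RCLike.I, -RCLike.I]

/-- The function `(y, x) ↦ ∫ ⟨x, p y⟩ dν(p)` for the scalar measure `ν` on the orbit closure with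
the given positive parts. -/
def barycenter (ν : Fin 4 → FiniteMeasure T.orbitClosure) (y : StrongDual 𝕜 X) (x : X) : 𝕜 :=
  ∑ k, unitCoeff 𝕜 k * ∫ p : T.orbitClosure, (p : WStarOp 𝕜 X) y x ∂(ν k : Measure T.orbitClosure)

/-- Multiples `r T(t)` with `‖r‖ ≤ 1` are represented by weighted point masses, and convex
combinations preserve the mass bounds. Compactness of the set of admissible measures lets the
representation survive closure. -/
theorem exists_barycenter {W : WStarOp 𝕜 X} (hW : W ∈ adjointClosure T.hullU) :
    ∃ ν : Fin 4 → FiniteMeasure T.orbitClosure, (∀ k, (ν k).mass ≤ 1) ∧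
      ∀ y x, W y x = T.barycenter ν y x := by
  let K := {ν : FiniteMeasure T.orbitClosure | ν.mass ≤ 1}
  have : CompactSpace K := isCompact_iff_compactSpace.1 (isCompact_setOf_mass_le_one _)
  let R : Set ((Fin 4 → K) × WStarOp 𝕜 X) :=
    {q | ∀ y x, q.2 y x = T.barycenter (fun k => (q.1 k : FiniteMeasure T.orbitClosure)) y x}
  have hint : ∀ y x, Continuous fun ν : FiniteMeasure T.orbitClosure =>
      ∫ p : T.orbitClosure, (p : WStarOp 𝕜 X) y x ∂(ν : Measure T.orbitClosure) := fun y x =>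
    continuous_iff_continuousAt.2 fun ν =>
      (FiniteMeasure.tendsto_iff_forall_integral_rclike_tendsto 𝕜).1 tendsto_id
        (BoundedContinuousFunction.mkOfCompact ⟨_, T.continuous_orbitClosure_eval y x⟩)
  have hR : IsClosed R := by
    simp only [R, ofPred_forall]
    refine isClosed_iInter fun y => isClosed_iInter fun x => isClosed_eq
      ((continuous_eval y x).comp continuous_snd) ?_
    refine continuous_finsetSum _ fun k _ => continuous_const.mul ((hint y x).comp ?_)
    fun_prop
  have hsnd := isClosedMap_snd_of_compactSpace _ hR
  -- Projection along the compact factor of measures is a closed map, so the representable operators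
  -- form a closed set.
  suffices h : adjoint '' T.hullU ⊆ Prod.snd '' R by
    obtain ⟨⟨ν, W'⟩, hν, rfl⟩ := closure_minimal h hsnd hW
    exact ⟨fun k => ν k, fun k => (ν k).2, hν⟩
  rw [hullU, absConvexHull_eq_convexHull_balancedHull, image_subset_iff]
  refine convexHull_min ?_ ?_
  · intro B hB
    obtain ⟨r, hr, _, ⟨t, rfl⟩, rfl⟩ := mem_balancedHull_iff.1 hB
    let δ : FiniteMeasure T.orbitClosure := ⟨Measure.dirac (T.toOrbitClosure t), inferInstance⟩
    have hδ : δ.mass = 1 := by simp [δ, FiniteMeasure.mass]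
    -- The weights are the positive and negative parts of the real and imaginary parts of `r`,
    -- matching `unitCoeff`.
    let c : Fin 4 → ℝ≥0 := ![(RCLike.re r).toNNReal, (-RCLike.re r).toNNReal,
      (RCLike.im r).toNNReal, (-RCLike.im r).toNNReal]
    have hre := (RCLike.abs_re_le_norm r).trans hr
    have him := (RCLike.abs_im_le_norm r).trans hr
    rw [abs_le] at hre him
    have hc : ∀ k, c k ≤ 1 := by
      intro k
      fin_cases k <;> simp [c] <;> linarith
    refine ⟨(fun k => ⟨c k • δ, ?_⟩, adjoint (r • T.op t)), fun y x => ?_, rfl⟩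
    · have hmass : (c k • δ).mass = c k * δ.mass := by simp [FiniteMeasure.mass]
      exact hmass.trans_le (by simpa [hδ] using hc k)
    · have hint' : ∀ k, ∫ p : T.orbitClosure, (p : WStarOp 𝕜 X) y x
          ∂((c k • δ : FiniteMeasure T.orbitClosure) : Measure T.orbitClosure) =
          ((c k : ℝ) : 𝕜) * y (T.op t x) := by
        intro k
        rw [FiniteMeasure.toMeasure_smul, integral_smul_nnreal_measure]
        simp only [δ, FiniteMeasure.toMeasure_mk]
        rw [integral_dirac' _ _ (T.continuous_orbitClosure_eval y x).stronglyMeasurable,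
          NNReal.smul_def, RCLike.real_smul_eq_coe_mul]
        rfl
      have hpart : ∀ a : ℝ, ((a.toNNReal : ℝ) : 𝕜) - (((-a).toNNReal : ℝ) : 𝕜) = (a : 𝕜) := by
        intro a
        rw [← RCLike.ofReal_sub, Real.coe_toNNReal', Real.coe_toNNReal',
          max_zero_sub_max_neg_zero_eq_self]
      have key : ∑ k, unitCoeff 𝕜 k * ((c k : ℝ) : 𝕜) = r := by
        conv_rhs => rw [← RCLike.re_add_im r, ← hpart (RCLike.re r), ← hpart (RCLike.im r)]
        simp only [Fin.sum_univ_four, unitCoeff, c, Matrix.cons_val]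
        ring
      simp only [barycenter, hint', ← mul_assoc, ← Finset.sum_mul, key]
      simp [adjoint_apply]
  · rintro B ⟨⟨ν, _⟩, hν, rfl : _ = adjoint B⟩ B' ⟨⟨ν', _⟩, hν', rfl : _ = adjoint B'⟩
      a b ha hb hab
    obtain ⟨a, ha0, rfl⟩ := RCLike.nonneg_iff_exists_ofReal.1 ha
    obtain ⟨b, hb0, rfl⟩ := RCLike.nonneg_iff_exists_ofReal.1 hb
    lift a to ℝ≥0 using ha0
    lift b to ℝ≥0 using hb0
    have hab' : a + b = 1 := by exact_mod_cast hab
    refine ⟨(fun k => ⟨a • (ν k).1 + b • (ν' k).1, ?_⟩,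
      adjoint (((a : ℝ) : 𝕜) • B + ((b : ℝ) : 𝕜) • B')), fun y x => ?_, rfl⟩
    · have hmass : (a • (ν k).1 + b • (ν' k).1).mass = a * (ν k).1.mass + b * (ν' k).1.mass := by
        simp [FiniteMeasure.mass]
      refine hmass.trans_le (hab' ▸ ?_)
      exact add_le_add (mul_le_of_le_one_right' (ν k).2) (mul_le_of_le_one_right' (ν' k).2)
    · have hint' : ∀ k, ∫ p : T.orbitClosure, (p : WStarOp 𝕜 X) y x
          ∂((a • (ν k).1 + b • (ν' k).1 : FiniteMeasure T.orbitClosure) :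
            Measure T.orbitClosure) =
          ((a : ℝ) : 𝕜) * ∫ p : T.orbitClosure, (p : WStarOp 𝕜 X) y x
            ∂((ν k).1 : Measure T.orbitClosure) +
          ((b : ℝ) : 𝕜) * ∫ p : T.orbitClosure, (p : WStarOp 𝕜 X) y x
            ∂((ν' k).1 : Measure T.orbitClosure) := by
        intro k
        rw [FiniteMeasure.toMeasure_add, integral_add_measure
          (T.integrable_orbitClosure_eval _ y x) (T.integrable_orbitClosure_eval _ y x),
          FiniteMeasure.toMeasure_smul, integral_smul_nnreal_measure,
          FiniteMeasure.toMeasure_smul, integral_smul_nnreal_measure]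
        simp only [NNReal.smul_def, RCLike.real_smul_eq_coe_mul]
      have h1 : y (B x) = _ := hν y x
      have h2 : y (B' x) = _ := hν' y x
      simp only [adjoint_apply, add_apply, smul_apply,
        map_add, map_smul, h1, h2, barycenter, hint', mul_add, Finset.sum_add_distrib,
        smul_eq_mul, Finset.mul_sum]
      congr 1 <;> exact Finset.sum_congr rfl fun k _ => by ring

/-- With `W` a barycenter, both sides are continuous in `V` and agree on the dense set of genuine
adjoints. Continuity of `V ↦ W (V y) x` is the delicate point and is where commutation with the
orbit closure enters. -/
theorem apply_comm_of_orbitClosure {𝒱 : Set (X →L[𝕜] X)} (h𝒱 : 𝒱 ⊆ T.hullU)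
    {y : StrongDual 𝕜 X} {x : X}
    (h : ∀ p ∈ adjointClosure T.orbitS, ∀ V ∈ adjointClosure 𝒱, p (V y) x = V (p y) x) :
    ∀ W ∈ adjointClosure T.hullU, ∀ V ∈ adjointClosure 𝒱, W (V y) x = V (W y) x := by
  intro W hW V hV
  obtain ⟨ν, -, hν⟩ := T.exists_barycenter hW
  have : CompactSpace (adjointClosure 𝒱) :=
    isCompact_iff_compactSpace.1 (T.isCompact_adjointClosure h𝒱)
  obtain ⟨C, hC⟩ : ∃ C : ℝ, ∀ (p : T.orbitClosure) (V : adjointClosure 𝒱),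
      ‖(V : WStarOp 𝕜 X) ((p : WStarOp 𝕜 X) y) x‖ ≤ C := by
    obtain ⟨M, hM0, hM⟩ := T.exists_bound_hullU
    refine ⟨M * (M * ‖y‖) * ‖x‖, fun p V => ?_⟩
    refine (norm_apply_le_of_mem_adjointClosure (fun B hB => hM B (h𝒱 hB)) V.2 _ _).trans ?_
    have hp : ‖(p : WStarOp 𝕜 X) y‖ ≤ M * ‖y‖ :=
      ContinuousLinearMap.opNorm_le_bound _ (by positivity) fun x =>
        norm_apply_le_of_mem_adjointClosure (fun B hB => hM B (T.orbitS_subset_hullU hB)) p.2 _ _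
    gcongr
  have hcont : Continuous fun V : adjointClosure 𝒱 => T.barycenter ν ((V : WStarOp 𝕜 X) y) x := by
    refine continuous_finsetSum _ fun k _ => continuous_const.mul ?_
    refine continuous_integral_of_separatelyContinuous _
      (fun (p : T.orbitClosure) (V : adjointClosure 𝒱) =>
        (p : WStarOp 𝕜 X) ((V : WStarOp 𝕜 X) y) x)
      (fun V => T.continuous_orbitClosure_eval _ x) (fun p => ?_) (C := C) (fun p V => ?_)
    -- `V ↦ p (V y) x` need not be continuous by itself; commutation turns it into the evaluation `V
    -- ↦ V (p y) x`.
    · simp only [fun V : adjointClosure 𝒱 => h p p.2 V V.2]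
      exact (continuous_eval _ _).comp continuous_subtype_val
    · rw [h p p.2 V V.2]; exact hC p V
  have heq := Continuous.ext_on dense_adjoint hcont
    ((continuous_eval (W y) x).comp continuous_subtype_val) (by
      rintro ⟨V, hV⟩ ⟨B, hB, rfl⟩
      change T.barycenter ν _ x = W y (B x)
      rw [hν]
      refine Finset.sum_congr rfl fun k _ => ?_
      congr 2
      ext p
      exact h p p.2 _ hV)
  rw [hν]
  exact congrFun heq ⟨V, hV⟩

/-- Enlarge one factor from `𝒮` to `𝒰`, exchange the roles, and enlarge the other. -/
theorem apply_comm_of_orbitS {y : StrongDual 𝕜 X} {x : X}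
    (h : ∀ U ∈ adjointClosure T.orbitS, ∀ V ∈ adjointClosure T.orbitS, U (V y) x = V (U y) x) :
    ∀ U ∈ adjointClosure T.hullU, ∀ V ∈ adjointClosure T.hullU, U (V y) x = V (U y) x :=
  T.apply_comm_of_orbitClosure subset_rfl fun p hp W hW =>
    (T.apply_comm_of_orbitClosure T.orbitS_subset_hullU h W hW p hp).symm

end BoundedC0Semigroup

/-! ### Ultrafilter limits and norming sets in weak duals -/

theorem exists_ultrafilter_tendsto_of_mem_closure_range {ι Y : Type*} [TopologicalSpace Y]
    {f : ι → Y} {y : Y} (hy : y ∈ closure (range f)) :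
    ∃ 𝒜 : Ultrafilter ι, Tendsto f 𝒜 (𝓝 y) := by
  have : (comap f (𝓝 y)).NeBot := by
    rw [comap_neBot_iff]
    intro s hs
    obtain ⟨_, h, i, rfl⟩ := mem_closure_iff_nhds.1 hy s hs
    exact ⟨i, h⟩
  exact ⟨Ultrafilter.of _, tendsto_iff_comap.2 (Ultrafilter.of_le _)⟩

/-- Evaluation at a point, as an element of the weak dual of `C_b`. -/
def pointEval (𝕜 : Type*) {S : Type*} [RCLike 𝕜] [TopologicalSpace S] (t : S) :
    WeakDual 𝕜 (S →ᵇ 𝕜) := BoundedContinuousFunction.evalCLM 𝕜 t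

/-- A point outside the closed absolutely convex hull of a set is separated from it by a continuous
functional. -/
theorem exists_separating_of_notMem_closure_absConvexHull {𝕜 F : Type*} [RCLike 𝕜]
    [AddCommGroup F] [Module 𝕜 F] [Module ℝ F] [IsScalarTower ℝ 𝕜 F] [TopologicalSpace F]
    [IsTopologicalAddGroup F] [ContinuousSMul 𝕜 F] [LocallyConvexSpace ℝ F] {D : Set F} {x : F}
    (hx : x ∉ closure (absConvexHull 𝕜 D)) :
    ∃ (f : StrongDual 𝕜 F) (u : ℝ), (∀ d ∈ D, ‖f d‖ ≤ u) ∧ u < RCLike.re (f x) := by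
  have hconv : Convex ℝ (absConvexHull 𝕜 D) := convex_absConvexHull.lift ℝ
  have : ContinuousSMul ℝ F := IsScalarTower.continuousSMul 𝕜
  obtain ⟨f, u, hu, hxu⟩ := RCLike.geometric_hahn_banach_closed_point (𝕜 := 𝕜) hconv.closure
    isClosed_closure hx
  refine ⟨f, u, fun d hd => ?_, hxu⟩
  -- Rotating `d` by a unimodular scalar stays in the balanced hull and upgrades the bound on the
  -- real part to one on the norm.
  obtain ⟨c, hc, hcd⟩ := RCLike.exists_norm_eq_mul_self (f d)
  have hmem : c • d ∈ absConvexHull 𝕜 D :=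
    balanced_absConvexHull.smul_mem hc.le (subset_absConvexHull hd)
  have h1 := hu _ (subset_closure hmem)
  rw [map_smul, smul_eq_mul, ← hcd, RCLike.ofReal_re] at h1
  exact h1.le

/-- The unit ball of a dual space is contained in the weak-* closed absolutely convex hull of any
norming set. -/
theorem mem_closure_absConvexHull_of_norming {𝕜 E : Type*} [RCLike 𝕜] [NormedAddCommGroup E]
    [NormedSpace 𝕜 E] {D : Set (WeakDual 𝕜 E)}
    (hD : ∀ (h : E) (u : ℝ), (∀ d ∈ D, ‖d h‖ ≤ u) → ‖h‖ ≤ u) (φ : WeakDual 𝕜 E)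
    (hφ : ‖WeakDual.toStrongDual φ‖ ≤ 1) : φ ∈ closure (absConvexHull 𝕜 D) := by
  by_contra hn
  let m : Module ℝ (WeakDual 𝕜 E) := inferInstanceAs (Module ℝ (WeakBilin (topDualPairing 𝕜 E)))
  have : IsScalarTower ℝ 𝕜 (WeakDual 𝕜 E) :=
    inferInstanceAs (IsScalarTower ℝ 𝕜 (WeakBilin (topDualPairing 𝕜 E)))
  have : LocallyConvexSpace ℝ (WeakDual 𝕜 E) :=
    inferInstanceAs (LocallyConvexSpace ℝ (WeakBilin (topDualPairing 𝕜 E)))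
  have : ContinuousSMul 𝕜 (WeakDual 𝕜 E) :=
    inferInstanceAs (ContinuousSMul 𝕜 (WeakBilin (topDualPairing 𝕜 E)))
  obtain ⟨F, u, hu, hφu⟩ := exists_separating_of_notMem_closure_absConvexHull hn
  -- Weak-* continuous functionals are evaluations at points of `E`.
  obtain ⟨h, rfl⟩ := LinearMap.dualEmbedding_surjective (topDualPairing 𝕜 E) F
  have h2 : RCLike.re (φ h) ≤ u :=
    (RCLike.re_le_norm _).trans (((WeakDual.toStrongDual φ).le_of_opNorm_le hφ h).trans
      (by simpa using hD h u hu))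
  exact absurd hφu (not_lt.2 h2)

/-! ### Weak almost periodicity as commutation, for a single pair -/

namespace BoundedC0Semigroup

open WStarOp

variable {𝕜 X : Type*} [RCLike 𝕜] [NormedAddCommGroup X] [NormedSpace 𝕜 X]
  (T : BoundedC0Semigroup 𝕜 X)

theorem exists_orbitFunction :
    ∃ L : StrongDual 𝕜 X →L[𝕜] X →L[𝕜] (ℝ≥0 →ᵇ 𝕜), ∀ y x t, L y x t = y (T.op t x) := by
  obtain ⟨M, hM⟩ := T.bounded
  have hM0 : 0 ≤ M := (norm_nonneg _).trans (hM 0)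
  have hbd : ∀ (y : StrongDual 𝕜 X) (x : X) (t : ℝ≥0), ‖y (T.op t x)‖ ≤ M * ‖y‖ * ‖x‖ := by
    intro y x t
    calc ‖y (T.op t x)‖ ≤ ‖y‖ * (M * ‖x‖) := y.le_opNorm_of_le ((T.op t).le_of_opNorm_le (hM t) x)
      _ = M * ‖y‖ * ‖x‖ := by ring
  let f : StrongDual 𝕜 X → X → (ℝ≥0 →ᵇ 𝕜) := fun y x =>
    BoundedContinuousFunction.ofNormedAddCommGroup (fun t => y (T.op t x))
      (y.continuous.comp (T.continuous_op_apply x)) (M * ‖y‖ * ‖x‖) (hbd y x)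
  refine ⟨(LinearMap.mk₂ 𝕜 f (fun y y' x => by ext; rfl) (fun c y x => by ext; rfl)
    (fun y x x' => by ext t; simp [f]) (fun c y x => by ext t; simp [f])).mkContinuous₂ M
    fun y x => ?_, fun y x t => rfl⟩
  exact BoundedContinuousFunction.norm_ofNormedAddCommGroup_le _ (by positivity) (hbd y x)

/-- The bounded continuous function `t ↦ ⟨T(t) x, y⟩`. -/
def orbitFunction : StrongDual 𝕜 X →L[𝕜] X →L[𝕜] (ℝ≥0 →ᵇ 𝕜) := T.exists_orbitFunction.choose

theorem orbitFunction_apply (y : StrongDual 𝕜 X) (x : X) (t : ℝ≥0) :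
    T.orbitFunction y x t = y (T.op t x) := T.exists_orbitFunction.choose_spec y x t

theorem op_comm (s t : ℝ≥0) (x : X) : T.op s (T.op t x) = T.op (s + t) x := by
  rw [T.op_add]; rfl

theorem translate_orbitFunction (y : StrongDual 𝕜 X) (x : X) (τ : ℝ≥0) :
    translateBCF (T.orbitFunction y x) τ = T.orbitFunction (adjoint (T.op τ) y) x := by
  ext t
  rw [orbitFunction_apply, adjoint_apply, op_comm, add_comm τ t]
  exact T.orbitFunction_apply y x (t + τ)

/-- Point evaluations norm `C_b`, so `φ` is a weak-* limit of absolutely convex combinations of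
them. Composition with the orbit map is weak-* continuous and sends evaluation at `t` to `T*(t)`. -/
theorem exists_adjointClosure_eq (φ : StrongDual 𝕜 (ℝ≥0 →ᵇ 𝕜)) (hφ : ‖φ‖ ≤ 1) :
    ∃ W ∈ adjointClosure T.hullU, ∀ y x, φ (T.orbitFunction y x) = W y x := by
  let θ : WeakDual 𝕜 (ℝ≥0 →ᵇ 𝕜) → WStarOp 𝕜 X := fun ψ =>
    (ContinuousLinearMap.compL 𝕜 X (ℝ≥0 →ᵇ 𝕜) 𝕜 (WeakDual.toStrongDual ψ)).comp T.orbitFunction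
  have hθ : ∀ ψ y x, θ ψ y x = ψ (T.orbitFunction y x) := fun _ _ _ => rfl
  have hcont : Continuous θ := continuous_of_eval fun y x => WeakDual.eval_continuous _
  refine ⟨θ (StrongDual.toWeakDual φ), ?_, fun y x => rfl⟩
  have hmaps : MapsTo θ (absConvexHull 𝕜 (range (pointEval 𝕜 (S := ℝ≥0)))) 
      (adjoint '' T.hullU) := by
    refine absConvexHull_min (t := θ ⁻¹' (adjoint '' T.hullU)) ?_ ⟨?_, ?_⟩
    · rintro _ ⟨t, rfl⟩
      refine ⟨T.op t, T.orbitS_subset_hullU ⟨t, rfl⟩, ?_⟩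
      refine DFunLike.ext _ _ fun y => ContinuousLinearMap.ext fun x => ?_
      exact (T.orbitFunction_apply y x t).symm
    · rw [balanced_iff_smul_mem]
      rintro a ha ψ ⟨B, hB, hBψ⟩
      refine ⟨a • B, balanced_absConvexHull.smul_mem ha hB, ?_⟩
      refine DFunLike.ext _ _ fun y => ContinuousLinearMap.ext fun x => ?_
      have h1 : y (B x) = ψ (T.orbitFunction y x) := by rw [← hθ, ← hBψ, adjoint_apply]
      rw [hθ, adjoint_apply, smul_apply, map_smul, h1]
      rfl
    · rintro ψ ⟨B, hB, hBψ⟩ ψ' ⟨B', hB', hBψ'⟩ a b ha hb hab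
      refine ⟨a • B + b • B', convex_absConvexHull hB hB' ha hb hab, ?_⟩
      refine DFunLike.ext _ _ fun y => ContinuousLinearMap.ext fun x => ?_
      have h1 : y (B x) = ψ (T.orbitFunction y x) := by rw [← hθ, ← hBψ, adjoint_apply]
      have h2 : y (B' x) = ψ' (T.orbitFunction y x) := by rw [← hθ, ← hBψ', adjoint_apply]
      rw [hθ, adjoint_apply, add_apply, smul_apply, smul_apply, map_add, map_smul, map_smul, h1, h2]
      rfl
  exact map_mem_closure hcont (mem_closure_absConvexHull_of_norming (fun h u hu =>
    BoundedContinuousFunction.norm_le_of_nonempty.2 fun t =>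
      hu (pointEval 𝕜 t) (mem_range_self t)) _ hφ) hmaps

/-- For `φ` in the unit ball, represented by `W`, commutation gives `φ (T.orbitFunction (p y) x) = W
(p y) x = p (W y) x`, which is continuous in `p`. Hence the compact orbit closure maps weakly
continuously onto a set containing all translates. -/
theorem isEberleinWAP_of_apply_comm {y : StrongDual 𝕜 X} {x : X}
    (h : ∀ U ∈ adjointClosure T.orbitS, ∀ V ∈ adjointClosure T.orbitS, U (V y) x = V (U y) x) :
    IsEberleinWAP 𝕜 fun t => y (T.op t x) := by
  refine ⟨T.orbitFunction y x, funext fun t => T.orbitFunction_apply y x t, ?_⟩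
  have hcomm := T.apply_comm_of_orbitS h
  let Θ : T.orbitClosure → WeakSpace 𝕜 (ℝ≥0 →ᵇ 𝕜) := fun p =>
    toWeakSpace 𝕜 _ (T.orbitFunction ((p : WStarOp 𝕜 X) y) x)
  have hball : ∀ φ : StrongDual 𝕜 (ℝ≥0 →ᵇ 𝕜), ‖φ‖ ≤ 1 → Continuous fun p : T.orbitClosure =>
      φ (T.orbitFunction ((p : WStarOp 𝕜 X) y) x) := by
    intro φ hφ
    obtain ⟨W, hW, hWφ⟩ := T.exists_adjointClosure_eq φ hφ
    simp only [hWφ, fun p : T.orbitClosure =>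
      hcomm W hW p (adjointClosure_mono T.orbitS_subset_hullU p.2)]
    exact T.continuous_orbitClosure_eval _ _
  have hscale : ∀ φ : StrongDual 𝕜 (ℝ≥0 →ᵇ 𝕜), Continuous fun p : T.orbitClosure =>
      φ (T.orbitFunction ((p : WStarOp 𝕜 X) y) x) := by
    intro φ
    rcases eq_or_ne φ 0 with rfl | hφ
    · exact continuous_const
    have hφ' : ‖φ‖ ≠ 0 := fun h0 => hφ ((ContinuousLinearMap.opNorm_zero_iff φ).1 h0)
    have h1 := (hball (((‖φ‖⁻¹ : ℝ) : 𝕜) • φ) (by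
      rw [norm_smul, RCLike.norm_ofReal, abs_of_nonneg (by positivity),
        inv_mul_cancel₀ hφ'])).const_smul ((‖φ‖ : ℝ) : 𝕜)
    refine h1.congr fun p => ?_
    simp only [Pi.smul_apply, smul_apply, smul_smul, ← RCLike.ofReal_mul, mul_inv_cancel₀ hφ',
      RCLike.ofReal_one, one_smul]
  have hcont : Continuous Θ := WeakBilin.continuous_of_continuous_eval _ hscale
  refine (isCompact_range hcont).closure_of_subset ?_
  rintro _ ⟨_, ⟨τ, rfl⟩, rfl⟩
  exact ⟨T.toOrbitClosure τ, by rw [translate_orbitFunction]; rfl⟩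

/-- A double limit: let translates converge weakly to `k` along an ultrafilter defining `U`, and
point evaluations converge weak-* to `φ` along one defining `V`. Then `φ k` equals `V (U y) x`
directly, and `U (V y) x` as the limit of `φ` on the translates. -/
theorem apply_comm_of_isEberleinWAP {y : StrongDual 𝕜 X} {x : X}
    (hf : IsEberleinWAP 𝕜 fun t => y (T.op t x)) :
    ∀ U ∈ adjointClosure T.orbitS, ∀ V ∈ adjointClosure T.orbitS, U (V y) x = V (U y) x := by
  intro U hU V hV
  obtain ⟨g, hg, hcomp⟩ := hf
  rw [adjointClosure, orbitS, ← range_comp] at hU hV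
  obtain ⟨𝒜, h𝒜⟩ := exists_ultrafilter_tendsto_of_mem_closure_range hU
  obtain ⟨ℬ, hℬ⟩ := exists_ultrafilter_tendsto_of_mem_closure_range hV
  rw [tendsto_iff] at h𝒜 hℬ
  simp only [Function.comp_apply, adjoint_apply] at h𝒜 hℬ
  obtain ⟨k, -, hk⟩ := hcomp.ultrafilter_le_nhds'
    (𝒜.map fun τ => toWeakSpace 𝕜 (ℝ≥0 →ᵇ 𝕜) (translateBCF g τ))
    (Ultrafilter.mem_map.2 (univ_mem' fun τ => subset_closure ⟨_, ⟨τ, rfl⟩, rfl⟩))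
  obtain ⟨k, rfl⟩ := (toWeakSpace 𝕜 (ℝ≥0 →ᵇ 𝕜)).surjective k
  have hk' : ∀ φ : StrongDual 𝕜 (ℝ≥0 →ᵇ 𝕜),
      Tendsto (fun τ => φ (translateBCF g τ)) 𝒜 (𝓝 (φ k)) := fun φ =>
    ((WeakBilin.eval_continuous (topDualPairing 𝕜 (ℝ≥0 →ᵇ 𝕜)).flip φ).tendsto _).comp hk
  have hgτ : ∀ τ t, translateBCF g τ t = y (T.op τ (T.op t x)) := by
    intro τ t
    rw [op_comm, add_comm τ t]
    exact congrFun hg (t + τ)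
  have hkU : ∀ t, k t = U y (T.op t x) := fun t =>
    tendsto_nhds_unique (hk' (BoundedContinuousFunction.evalCLM 𝕜 t)) (by
      simpa [hgτ] using h𝒜 y (T.op t x))
  obtain ⟨φ, -, hφ⟩ := (WeakDual.isCompact_closedBall (0 : StrongDual 𝕜 (ℝ≥0 →ᵇ 𝕜)) 1
    ).ultrafilter_le_nhds' (ℬ.map (pointEval 𝕜)) (Ultrafilter.mem_map.2 (univ_mem' fun t => by
      simp only [mem_preimage, mem_closedBall_zero_iff]
      exact ContinuousLinearMap.opNorm_le_bound _ zero_le_one fun h => by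
        rw [one_mul]; exact h.norm_coe_le_norm t))
  have hφ' : ∀ h : ℝ≥0 →ᵇ 𝕜, Tendsto (fun t => h t) ℬ (𝓝 (φ h)) := fun h =>
    ((WeakDual.eval_continuous h).tendsto φ).comp hφ
  have h1 : φ k = V (U y) x := tendsto_nhds_unique (hφ' k) (by
    simpa only [hkU] using hℬ (U y) x)
  have h2 : ∀ τ, φ (translateBCF g τ) = V y (T.op τ x) := fun τ =>
    tendsto_nhds_unique (hφ' _) (by
      refine (hℬ y (T.op τ x)).congr fun t => ?_
      rw [hgτ, op_comm, op_comm, add_comm])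
  rw [← h1]
  refine tendsto_nhds_unique (h𝒜 (V y) x) ?_
  exact (hk' (WeakDual.toStrongDual φ)).congr h2

/-- The commutation conditions for `𝒮` and `𝒰` are equivalent, so any `𝒱` in between gives the same
one. -/
theorem isEberleinWAP_iff_apply_comm {𝒱 : Set (X →L[𝕜] X)} (h1 : T.orbitS ⊆ 𝒱) (h2 : 𝒱 ⊆ T.hullU)
    (y : StrongDual 𝕜 X) (x : X) : (IsEberleinWAP 𝕜 fun t => y (T.op t x)) ↔
      ∀ U ∈ adjointClosure 𝒱, ∀ V ∈ adjointClosure 𝒱, U (V y) x = V (U y) x :=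
  ⟨fun h U hU V hV => T.apply_comm_of_orbitS (T.apply_comm_of_isEberleinWAP h)
      U (adjointClosure_mono h2 hU) V (adjointClosure_mono h2 hV),
    fun h => T.isEberleinWAP_of_apply_comm fun U hU V hV =>
      h U (adjointClosure_mono h1 hU) V (adjointClosure_mono h1 hV)⟩

end BoundedC0Semigroup

/-! ### Averages near zero, and passage from the sun dual to `X*` -/

namespace BoundedC0Semigroup

open WStarOp

variable {𝕜 X : Type*} [RCLike 𝕜] [NormedAddCommGroup X] [NormedSpace 𝕜 X]
  (T : BoundedC0Semigroup 𝕜 X)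

/-- The averages `n ∫₀^{1/n} T(s) ds` commute with the commutant of the semigroup, converge strongly
to the identity, and their adjoints map into the sun dual. -/
theorem exists_average [CompleteSpace X] : ∃ A : ℕ → X →L[𝕜] X,
    (∀ n (B : X →L[𝕜] X), (∀ t, B.comp (T.op t) = (T.op t).comp B) →
      B.comp (A n) = (A n).comp B) ∧
    (∀ n (y : StrongDual 𝕜 X), adjoint (A n) y ∈ T.sunDual) ∧
    ∀ x, Tendsto (fun n => A n x) atTop (𝓝 x) := by
  let _ : NormedSpace ℝ X := NormedSpace.restrictScalars ℝ 𝕜 X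
  have : IsScalarTower ℝ 𝕜 X := RestrictScalars.isScalarTower ℝ 𝕜 X
  obtain ⟨M, hM⟩ := T.bounded
  have hM0 : 0 ≤ M := (norm_nonneg _).trans (hM 0)
  have hcont : ∀ x, Continuous fun s : ℝ => T.op s.toNNReal x := fun x =>
    (T.continuous_op_apply x).comp continuous_real_toNNReal
  have hii : ∀ x a b, IntervalIntegrable (fun s : ℝ => T.op s.toNNReal x) volume a b :=
    fun x a b => (hcont x).intervalIntegrable a b
  have hbd : ∀ x a b, ‖∫ s in a..b, T.op s.toNNReal x‖ ≤ M * ‖x‖ * |b - a| := fun x a b =>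
    intervalIntegral.norm_integral_le_of_norm_le_const fun s _ =>
      (T.op _).le_of_opNorm_le (hM _) x
  let J : ℝ → X →L[𝕜] X := fun h => LinearMap.mkContinuous
    { toFun := fun x => ∫ s in (0 : ℝ)..h, T.op s.toNNReal x
      map_add' := fun x x' => by
        simp only [map_add]
        exact intervalIntegral.integral_add (hii _ _ _) (hii _ _ _)
      map_smul' := fun c x => by
        simp only [map_smul, RingHom.id_apply]
        exact intervalIntegral.integral_smul c _ } (M * |h|) fun x => by
        refine (hbd x 0 h).trans (le_of_eq ?_)
        rw [sub_zero]; ring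
  have hJ : ∀ h x, J h x = ∫ s in (0 : ℝ)..h, T.op s.toNNReal x := fun _ _ => rfl
  -- The shift by one keeps the interval length finite and positive at `n = 0`.
  let h : ℕ → ℝ := fun n => 1 / ((n : ℝ) + 1)
  have hpos : ∀ n, 0 < h n := fun n => by positivity
  let A : ℕ → X →L[𝕜] X := fun n => (((h n)⁻¹ : ℝ) : 𝕜) • J (h n)
  refine ⟨A, fun n B hB => ?_, fun n y => ?_, fun x => ?_⟩
  · ext x
    have h1 : B (J (h n) x) = J (h n) (B x) := by
      rw [hJ, hJ, ← B.intervalIntegral_comp_comm (hii x _ _)]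
      refine intervalIntegral.integral_congr fun s _ => ?_
      exact DFunLike.congr_fun (hB s.toNNReal) x
    simp only [A, ContinuousLinearMap.comp_apply, smul_apply, map_smul, h1]
  · rw [mem_sunDual, tendsto_iff_norm_sub_tendsto_zero]
    -- The overlap cancels, leaving two integrals over intervals of length `t`; this yields a norm
    -- bound linear in `t`.
    have hJT : ∀ (t : ℝ≥0) x, J (h n) (T.op t x) - J (h n) x =
        (∫ s in (h n)..(h n + t), T.op s.toNNReal x) - ∫ s in (0 : ℝ)..t, T.op s.toNNReal x := by
      intro t x
      have h1 : J (h n) (T.op t x) = ∫ s in (t : ℝ)..(h n + t), T.op s.toNNReal x := by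
        have h2 := intervalIntegral.integral_comp_add_right (a := 0) (b := h n)
          (fun s : ℝ => T.op s.toNNReal x) t
        rw [zero_add] at h2
        rw [hJ, ← h2]
        refine intervalIntegral.integral_congr fun s hs => ?_
        rw [uIcc_of_le (hpos n).le] at hs
        rw [op_comm, Real.toNNReal_add hs.1 t.coe_nonneg, Real.toNNReal_coe]
      rw [h1, hJ, ← intervalIntegral.integral_add_adjacent_intervals (hii x 0 t) (hii x t (h n)),
        ← intervalIntegral.integral_add_adjacent_intervals (hii x t (h n)) (hii x _ (h n + t))]
      abel
    have hle : ∀ t : ℝ≥0, ‖T.dualOp t (adjoint (A n) y) - adjoint (A n) y‖ ≤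
        2 * M * ‖y‖ * (h n)⁻¹ * t := by
      intro t
      refine ContinuousLinearMap.opNorm_le_bound _ (by have := hpos n; positivity) fun x => ?_
      have h1 : (T.dualOp t (adjoint (A n) y) - adjoint (A n) y) x =
          y ((((h n)⁻¹ : ℝ) : 𝕜) • (J (h n) (T.op t x) - J (h n) x)) := by
        rw [sub_apply, dualOp_apply, adjoint_apply, adjoint_apply, ← map_sub, smul_sub]
        rfl
      rw [h1, hJT]
      refine (y.le_opNorm _).trans ?_
      rw [norm_smul, RCLike.norm_ofReal, abs_of_nonneg (inv_nonneg.2 (hpos n).le)]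
      have h2 := hbd x (h n) (h n + t)
      have h3 := hbd x 0 t
      rw [add_sub_cancel_left, NNReal.abs_eq] at h2
      rw [sub_zero, NNReal.abs_eq] at h3
      have h4 := (norm_sub_le (∫ s in (h n)..(h n + t), T.op s.toNNReal x)
        (∫ s in (0 : ℝ)..t, T.op s.toNNReal x)).trans (add_le_add h2 h3)
      have hpos' := inv_nonneg.2 (hpos n).le
      calc ‖y‖ * ((h n)⁻¹ * _) ≤ ‖y‖ * ((h n)⁻¹ * (M * ‖x‖ * t + M * ‖x‖ * t)) := by gcongr
        _ = 2 * M * ‖y‖ * (h n)⁻¹ * t * ‖x‖ := by ring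
    refine squeeze_zero (fun _ => norm_nonneg _) hle ?_
    have : Continuous fun t : ℝ≥0 => 2 * M * ‖y‖ * (h n)⁻¹ * (t : ℝ) := by fun_prop
    simpa using this.tendsto 0
  -- `Real.toNNReal` extends the orbit by the constant `x` to negative times, so the two-sided
  -- derivative at `0` exists; the averages are its difference quotients.
  · have hd : HasDerivAt (fun r : ℝ => ∫ s in (0 : ℝ)..r, T.op s.toNNReal x)
        (T.op (0 : ℝ).toNNReal x) 0 :=
      intervalIntegral.integral_hasDerivAt_right (hii x 0 0)
        (hcont x).stronglyMeasurable.stronglyMeasurableAtFilter (hcont x).continuousAt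
    have hh : Tendsto h atTop (𝓝[≠] 0) := by
      refine tendsto_nhdsWithin_iff.2 ⟨tendsto_one_div_add_atTop_nhds_zero_nat, ?_⟩
      exact .of_forall fun n => (hpos n).ne'
    have h1 := (hasDerivAt_iff_tendsto_slope.1 hd).comp hh
    rw [Real.toNNReal_zero, T.op_zero] at h1
    refine h1.congr fun n => ?_
    simp only [Function.comp_apply, slope_def_module, intervalIntegral.integral_same, sub_zero, A,
      smul_apply, hJ]
    rw [← RCLike.real_smul_eq_coe_smul]

/-- The adjoints of the averages `A n` map `y` into the sun dual and commute with `U` and `V`. This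
moves `A n` onto `x`, and `A n x → x`. -/
theorem apply_comm_of_sunDual [CompleteSpace X] {𝒱 : Set (X →L[𝕜] X)} (h𝒱 : 𝒱 ⊆ T.hullU) {x : X}
    {U V : WStarOp 𝕜 X} (hU : U ∈ adjointClosure 𝒱) (hV : V ∈ adjointClosure 𝒱)
    (h : ∀ y ∈ T.sunDual, U (V y) x = V (U y) x) (y : StrongDual 𝕜 X) : U (V y) x = V (U y) x := by
  obtain ⟨A, hcomm, hsun, hlim⟩ := T.exists_average
  have hA : ∀ n, ∀ W ∈ adjointClosure 𝒱, ∀ z, W (adjoint (A n) z) = adjoint (A n) (W z) :=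
    fun n W hW z => ContinuousLinearMap.ext fun x' =>
      apply_comm_of_mem_adjointClosure hW
        (fun B hB => hcomm n B fun t => T.hullU_comm B (h𝒱 hB) t) z x'
  have heq : ∀ n, U (V y) (A n x) = V (U y) (A n x) := by
    intro n
    have := h _ (hsun n y)
    rwa [hA n V hV, hA n U hU, hA n U hU, hA n V hV] at this
  refine tendsto_nhds_unique (((U (V y)).continuous.tendsto x).comp (hlim x)) ?_
  exact (((V (U y)).continuous.tendsto x).comp (hlim x)).congr fun n => (heq n).symm

end BoundedC0Semigroup

end

/-! ### The two equivalences -/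

theorem theorem6p6 {𝕜 X : Type*} [RCLike 𝕜] [NormedAddCommGroup X] [NormedSpace 𝕜 X]
    [CompleteSpace X] (T : BoundedC0Semigroup 𝕜 X) (𝒱 : Set (X →L[𝕜] X))
    (h𝒱 : 𝒱 = T.orbitS ∨ 𝒱 = T.hullT ∨ 𝒱 = T.hullU) :
    (∀ x : X,
      (∀ y : T.sunDual, IsEberleinWAP 𝕜 fun t => (y : StrongDual 𝕜 X) (T.op t x)) ↔
        ∀ U ∈ compactification 𝒱, ∀ V ∈ compactification 𝒱, circ U V x = circ V U x) ∧
    (∀ y : T.sunDual,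
      (∀ x : X, IsEberleinWAP 𝕜 fun t => (T.sunOp t y : StrongDual 𝕜 X) x) ↔
        ∀ U ∈ T.sunCompactification 𝒱, ∀ V ∈ T.sunCompactification 𝒱, U (V y) = V (U y)) := by
  have h1 : T.orbitS ⊆ 𝒱 := by
    rcases h𝒱 with rfl | rfl | rfl
    exacts [subset_rfl, subset_convexHull 𝕜 _, T.orbitS_subset_hullU]
  have h2 : 𝒱 ⊆ T.hullU := by
    rcases h𝒱 with rfl | rfl | rfl
    exacts [T.orbitS_subset_hullU, T.hullT_subset_hullU, subset_rfl]
  have hpair := T.isEberleinWAP_iff_apply_comm h1 h2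
  refine ⟨fun x => ⟨fun h U hU V hV => ?_, fun h y => ?_⟩, fun y => ⟨fun h => ?_, fun h x => ?_⟩⟩
  · ext y
    -- The roles are exchanged because `eta` reverses products: `circ U V x y = eta V (eta U y) x`.
    exact T.apply_comm_of_sunDual h2 (U := (eta V : WStarOp 𝕜 X)) (V := (eta U : WStarOp 𝕜 X))
      hV hU (fun y hy => (hpair y x).1 (h ⟨y, hy⟩) _ hV _ hU) y
  · refine (hpair y x).2 fun U hU V hV => ?_
    exact DFunLike.congr_fun (h _ (WStarOp.flip_mem_compactification hV) _
      (WStarOp.flip_mem_compactification hU)) (y : StrongDual 𝕜 X)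
  · rintro _ ⟨U, hU, hU', rfl⟩ _ ⟨V, hV, hV', rfl⟩
    refine Subtype.ext (ContinuousLinearMap.ext fun x => ?_)
    exact (hpair y x).1 (h x) _ hU _ hV
  · refine (hpair y x).2 fun U hU V hV => ?_
    have huv := h _ ⟨_, WStarOp.flip_mem_compactification hU, 
        T.eta_mem_sunDual h2 (WStarOp.flip_mem_compactification hU), rfl⟩
      _ ⟨_, WStarOp.flip_mem_compactification hV, 
        T.eta_mem_sunDual h2 (WStarOp.flip_mem_compactification hV), rfl⟩
    exact DFunLike.congr_fun (congrArg Subtype.val huv) x
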